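/- Let $\mathcal{G}$ be the group (under composition) of polynomial automorphisms $\theta=(F_1,F_2)$, $F_1,F_2\in\mathbb{C}[X,Y]$, of the complex affine plane, and put $\deg\theta=\max(\deg F_1,\deg F_2)$. Let $\mathcal{A}\subset\mathcal{G}$ be the subgroup of affine automorphisms (those of degree one) and $\mathcal{B}\subset\mathcal{G}$ the subgroup of triangular automorphisms $(aX+P(Y),\,bY+c)$ with $a,b\in\mathbb{C}^*$, $c\in\mathbb{C}$, $P\in\mathbb{C}[Y]$. For a sequence $(d_1,\dots,d_k)$ of natural numbers let $\mathcal{G}_{(d_1,\dots,d_k)}$ be the set of automorphisms of polydegree $(d_1,\dots,d_k)$, that is, of those $\theta\in\mathcal{G}$ that can be written as $$\theta=\alpha_0\tau_1\alpha_1\cdots\tau_k\alpha_k$$ with $\alpha_0,\dots,\alpha_k\in\mathcal{A}$, $\alpha_i\notin\mathcal{B}$ for $0<i<k$, and $\tau_i\in\mathcal{B}\setminus\mathcal{A}$ with $\deg\tau_i=d_i$ for $1\le i\le k$. Equip $\mathcal{G}=\bigcup_n\mathcal{G}_{\le n}$, where $\mathcal{G}_{\le n}=\{\theta\in\mathcal{G}:\deg\theta\le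 n\}$, with the Zariski topology of an ind-variety: a subset $C\subset\mathcal{G}$ is closed if and only if, for every $n$, $C\cap\mathcal{G}_{\le n}$ is the set of points of $\mathcal{G}_{\le n}$ at which some family of polynomials in the coefficients of $F_1,F_2$ vanishes. Let $\overline{A}$ denote the closure of $A\subset\mathcal{G}$ in this topology. **Theorem (Edo).** Let $d,e\ge 2$ be integers with $d-1=me$ for some $m\in\mathbb{N}$. Then $\mathcal{G}_{(d+e)}\subset\overline{\mathcal{G}_{(d,e+1)}}$. -/

import Mathlib

noncomputable section

/-- The group `𝒢(K)` of polynomial automorphisms of the affine plane over `K`. An automorphism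
`θ = (F₁, F₂)` is stored as the `K`-algebra automorphism `X ↦ F₁, Y ↦ F₂` of `K[X, Y]`; the
opposite group is taken so that the product is composition of maps of the plane
(see `PlaneAut.coord_mul`). -/
def PlaneAut (K : Type*) [Field K] : Type _ :=
  (MvPolynomial (Fin 2) K ≃ₐ[K] MvPolynomial (Fin 2) K)ᵐᵒᵖ

namespace PlaneAut

instance instGroup (K : Type*) [Field K] : Group (PlaneAut K) :=
  inferInstanceAs (Group (MvPolynomial (Fin 2) K ≃ₐ[K] MvPolynomial (Fin 2) K)ᵐᵒᵖ)

/-- The components `F₁ = θ.coord 0`, `F₂ = θ.coord 1` of `θ = (F₁, F₂)`, as polynomials in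
`X = X 0` and `Y = X 1`. -/
def coord {K : Type*} [Field K] (θ : PlaneAut K) (i : Fin 2) : MvPolynomial (Fin 2) K :=
  (MulOpposite.unop θ : MvPolynomial (Fin 2) K ≃ₐ[K] MvPolynomial (Fin 2) K) (MvPolynomial.X i)

/-- The product is composition: `θ * σ = (F₁(G₁, G₂), F₂(G₁, G₂))` for `θ = (F₁, F₂)` and
`σ = (G₁, G₂)`. -/
theorem coord_mul {K : Type*} [Field K] (θ σ : PlaneAut K) (i : Fin 2) :
    (θ * σ).coord i = MvPolynomial.aeval σ.coord (θ.coord i) := by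
  have h : MvPolynomial.aeval σ.coord =
      (((MulOpposite.unop σ : MvPolynomial (Fin 2) K ≃ₐ[K] MvPolynomial (Fin 2) K)) :
        MvPolynomial (Fin 2) K →ₐ[K] MvPolynomial (Fin 2) K) := by
    apply MvPolynomial.algHom_ext
    intro j
    simp [coord]
  rw [h]
  rfl

/-- The degree of `θ = (F₁, F₂)` is `max (deg F₁) (deg F₂)`. -/
def degree {K : Type*} [Field K] (θ : PlaneAut K) : ℕ :=
  max (θ.coord 0).totalDegree (θ.coord 1).totalDegree

/-- The affine automorphisms: those of degree one. -/
def affine (K : Type*) [Field K] : Set (PlaneAut K) :=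
  {θ | θ.degree = 1}

/-- The (upper) triangular automorphisms `(aX + P(Y), bY + c)` with `a, b ≠ 0`. -/
def triangular (K : Type*) [Field K] : Set (PlaneAut K) :=
  {θ | ∃ (a b c : K) (P : Polynomial K), a ≠ 0 ∧ b ≠ 0 ∧
    θ.coord 0 = MvPolynomial.C a * MvPolynomial.X 0 + Polynomial.aeval (MvPolynomial.X 1) P ∧
    θ.coord 1 = MvPolynomial.C b * MvPolynomial.X 1 + MvPolynomial.C c}

/-- `𝒢_{(d₁, …, d_k)}(K)`: the automorphisms of polydegree `(d₁, …, d_k)`, i.e. those with a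
reduced factorization `α₀ τ₁ α₁ ⋯ τ_k α_k` in the amalgamated product, where the `α_i` are affine,
the inner ones (`0 < i < k`) are not triangular, and the `τ_i` are triangular, not affine, of
degree `d_i`. -/
def polydegreeSet (K : Type*) [Field K] {k : ℕ} (d : Fin k → ℕ) : Set (PlaneAut K) :=
  {θ | ∃ (α : Fin (k + 1) → PlaneAut K) (τ : Fin k → PlaneAut K),
    (∀ i, α i ∈ affine K) ∧
    (∀ i, i ≠ 0 → i ≠ Fin.last k → α i ∉ triangular K) ∧
    (∀ i, τ i ∈ triangular K ∧ τ i ∉ affine K ∧ (τ i).degree = d i) ∧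
    θ = α 0 * (List.ofFn fun i : Fin k => τ i * α i.succ).prod}

/-- The coefficients of the two components of `θ`: the coefficient of the monomial `m` in
component `i` has index `(i, m)`. -/
def coeffs {K : Type*} [Field K] (θ : PlaneAut K) (p : Fin 2 × (Fin 2 →₀ ℕ)) : K :=
  (θ.coord p.1).coeff p.2

/-- `C` meets `𝒢_{≤ n} = {θ | deg θ ≤ n}` in a Zariski closed subset of `𝒢_{≤ n}`, i.e. in the
common zero set of a family of polynomials in the coefficients. (On `𝒢_{≤ n}` only the finitely
many coefficients of monomials of degree `≤ n` can be nonzero.) -/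
def IsClosedInDegree {K : Type*} [Field K] (C : Set (PlaneAut K)) (n : ℕ) : Prop :=
  ∃ S : Set (MvPolynomial (Fin 2 × (Fin 2 →₀ ℕ)) K),
    ∀ θ : PlaneAut K, θ.degree ≤ n → (θ ∈ C ↔ ∀ f ∈ S, MvPolynomial.eval θ.coeffs f = 0)

/-- The Zariski topology of the ind-variety `𝒢(K) = ⋃ₙ 𝒢_{≤ n}`: a set is closed iff its
intersection with each `𝒢_{≤ n}` is Zariski closed in `𝒢_{≤ n}`. -/
instance zariskiTopology (K : Type*) [Field K] : TopologicalSpace (PlaneAut K) :=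
  TopologicalSpace.ofClosed {C | ∀ n, IsClosedInDegree C n}
    (fun _ => ⟨{1}, fun θ _ => by simp⟩)
    (by
      intro A hA n
      choose! S hS using fun C (hC : C ∈ A) => hA hC n
      refine ⟨⋃ C ∈ A, S C, fun θ hθ => ?_⟩
      simp only [Set.mem_sInter, Set.mem_iUnion]
      constructor
      · rintro h f ⟨C, hC, hf⟩
        exact (hS C hC θ hθ).1 (h C hC) f hf
      · intro h C hC
        exact (hS C hC θ hθ).2 fun f hf => h f ⟨C, hC, hf⟩)
    (by
      intro A hA B hB n
      obtain ⟨S, hS⟩ := hA n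
      obtain ⟨T, hT⟩ := hB n
      refine ⟨{h | ∃ f ∈ S, ∃ g ∈ T, h = f * g}, fun θ hθ => ?_⟩
      rw [Set.mem_union, hS θ hθ, hT θ hθ]
      constructor
      · rintro (h | h) _ ⟨f, hf, g, hg, rfl⟩
        · simp [h f hf]
        · simp [h g hg]
      · intro h
        by_contra! hc
        obtain ⟨⟨f, hf, hf0⟩, ⟨g, hg, hg0⟩⟩ := hc
        have := h _ ⟨f, hf, g, hg, rfl⟩
        rw [map_mul] at this
        exact (mul_ne_zero hf0 hg0) this)

theorem isClosed_iff {K : Type*} [Field K] (C : Set (PlaneAut K)) :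
    IsClosed C ↔ ∀ n, IsClosedInDegree C n := by
  rw [← isOpen_compl_iff]
  change Cᶜᶜ ∈ {C : Set (PlaneAut K) | ∀ n, IsClosedInDegree C n} ↔ _
  rw [compl_compl]
  rfl

end PlaneAut

end

/-! The closure statement comes from Lagrange inversion. Let `q` have degree `e + 1`. The inverse of
`y + t q(y)` as a power series in `t` is `∑ t^k L_k`, with `L_0 = y` and `L_k = ((-1)^k / k!)
D^(k-1)(q^k)` of degree `k e + 1`. Truncate it after order `m` and add `t^(m+1) β` with `deg β ≤ m
e`; for `t ≠ 0` the result `B` has degree `m e + 1 = d`. At `U = y + t q(y) + t^(m+1) x` one gets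
`B(U) = y + t^(m+1) (x + β(y) - L_{m+1}(y))` modulo `t^(m+2)`. Hence `(a t^(-(m+1)) (B(U) - y), b U
+ c)`, a product of triangular maps of degrees `d` and `e + 1` with a swap between them, extends
polynomially to `t = 0`, with value `(a x + a (β - L_{m+1})(y), b y + c)` (`exists_degeneration`).

Every triangular map of degree `d + e = (m + 1) e + 1` is such a limit: integrating `m` times and
extracting an approximate `(m + 1)`-th root gives `q` such that `-L_{m+1}` has the prescribed top
coefficients, and `β` absorbs the rest (`exists_natDegree_add_inverseCoeff_le`). Limits of
polynomial families lie in the Zariski closure (`IsPolynomialFamily.mem_closure`), and the outer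
affine factors are carried along. -/

noncomputable section

/-! ### Lagrange inversion for `X + t q(X)` -/

namespace Polynomial

/-- With `y` a second variable, `(q(X) - q(y))^n` vanishes to order `n` at `X = y`, so its `r`-th
derivative in `X` vanishes there; the sum is the binomial expansion of that derivative. -/
theorem sum_choose_mul_iterate_derivative_pow_eq_zero {R : Type*} [CommRing R] (q : R[X])
    {r n : ℕ} (h : r < n) :
    ∑ k ∈ Finset.range (n + 1),
      (n.choose k : R[X]) * (-q) ^ (n - k) * derivative^[r] (q ^ k) = 0 := by
  -- In `R[X][X]` the outer variable is differentiated, and the inner one is the point `y`.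
  have key : eval X (derivative^[r] ((q.map C + C (-q)) ^ n)) = 0 := by
    refine eval_eq_zero_of_dvd_of_eval_eq_zero
      ((dvd_pow_self _ (Nat.sub_ne_zero_of_lt h)).trans
        (pow_sub_dvd_iterate_derivative_pow _ n r)) ?_
    simp [eval_map]
  rw [add_pow, iterate_derivative_sum, eval_finsetSum] at key
  rw [← key]
  refine Finset.sum_congr rfl fun k _ => ?_
  have : (q.map C : R[X][X]) ^ k * C (-q) ^ (n - k) * (n.choose k : R[X][X]) =
      C ((n.choose k : R[X]) * (-q) ^ (n - k)) * (q ^ k).map C := by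
    simp only [map_mul, map_pow, map_natCast, Polynomial.map_pow]
    ring
  rw [this, iterate_derivative_C_mul, iterate_derivative_map, eval_mul, eval_C, eval_map,
    eval₂_C_X]

/-- The coefficient of `t ^ k` in the compositional inverse of `X + t q(X)`. -/
def inverseCoeff {K : Type*} [Field K] (q : K[X]) : ℕ → K[X]
  | 0 => X
  | k + 1 => C ((-1) ^ (k + 1) / ((k + 1).factorial : K)) * derivative^[k] (q ^ (k + 1))

theorem iterate_derivative_inverseCoeff {K : Type*} [Field K] (q : K[X]) {k n : ℕ}
    (h : k ≤ n + 1) :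
    derivative^[n + 1 - k] (inverseCoeff q k) =
      C ((-1) ^ k / (k.factorial : K)) * derivative^[n] (q ^ k) := by
  cases k with
  | zero => simp [inverseCoeff]
  | succ k =>
    rw [inverseCoeff, iterate_derivative_C_mul, ← Function.iterate_add_apply]
    congr 3
    omega

/-- This is the coefficient of `t^n` in `∑ t^k L_k(y + t q(y))`. Multiplied by `n!`, it becomes, up
to sign, the preceding binomial sum with `r = n - 1`. -/
theorem sum_pow_mul_hasseDeriv_inverseCoeff {K : Type*} [Field K] [CharZero K] (q : K[X])
    {n : ℕ} (hn : n ≠ 0) :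
    ∑ k ∈ Finset.range (n + 1), q ^ (n - k) * hasseDeriv (n - k) (inverseCoeff q k) = 0 := by
  obtain ⟨r, rfl⟩ := Nat.exists_eq_succ_of_ne_zero hn
  have hf : ∀ j : ℕ, (C (j.factorial : K)) ≠ 0 := fun j => by
    simpa using Nat.factorial_ne_zero j
  have h1 : ∀ (j : ℕ) (f : K[X]), C (j.factorial : K) * hasseDeriv j f = derivative^[j] f := by
    intro j f
    rw [← factorial_smul_hasseDeriv]
    simp [nsmul_eq_mul]
  refine (mul_eq_zero_iff_left (hf (r + 1))).1 ?_
  refine Eq.trans ?_ (congrArg (fun z => (-1 : K[X]) ^ (r + 1) * z)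
    (sum_choose_mul_iterate_derivative_pow_eq_zero q (Nat.lt_succ_self r)) |>.trans (mul_zero _))
  rw [Finset.mul_sum, Finset.mul_sum]
  refine Finset.sum_congr rfl fun k hk => ?_
  have hk : k ≤ r + 1 := Nat.lt_succ_iff.1 (Finset.mem_range.1 hk)
  have h2 := h1 (r + 1 - k) (inverseCoeff q k)
  rw [iterate_derivative_inverseCoeff q hk] at h2
  have h3 : (C ((k.factorial : K)) : K[X]) * C ((-1) ^ k / (k.factorial : K)) = (-1) ^ k := by
    rw [← C_mul, mul_div_cancel₀]
    · simp
    · exact_mod_cast Nat.factorial_ne_zero k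
  have h4 : (C (((r + 1).factorial : ℕ) : K) : K[X]) =
      ((r + 1).choose k : K[X]) * C (k.factorial : K) * C ((r + 1 - k).factorial : K) := by
    rw [← Nat.choose_mul_factorial_mul_factorial hk]
    simp
  have h5 : (-1 : K[X]) ^ (r + 1) * (-q) ^ (r + 1 - k) = (-1) ^ k * q ^ (r + 1 - k) := by
    obtain ⟨j, hj⟩ := Nat.exists_eq_add_of_le hk
    rw [hj, Nat.add_sub_cancel_left, neg_pow q, pow_add]
    have : (-1 : K[X]) ^ j * (-1) ^ j = 1 := by rw [← mul_pow]; simp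
    linear_combination ((-1) ^ k * q ^ j) * this
  simp only [Nat.succ_eq_add_one] at *
  rw [h4]
  linear_combination (((r + 1).choose k : K[X]) * C (k.factorial : K) * q ^ (r + 1 - k)) * h2
    + (((r + 1).choose k : K[X]) * q ^ (r + 1 - k) * derivative^[r] (q ^ k)) * h3
    - (((r + 1).choose k : K[X]) * derivative^[r] (q ^ k)) * h5

/-- Taylor expansion with remainder; Hasse derivatives avoid dividing by factorials. -/
theorem pow_dvd_aeval_add_sub {K A : Type*} [CommRing K] [CommRing A] [Algebra K A] (f : K[X])
    (y s : A) (N : ℕ) :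
    s ^ N ∣ aeval (y + s) f - ∑ j ∈ Finset.range N, s ^ j * aeval y (hasseDeriv j f) := by
  have h : (X : A[X]) ^ N ∣ taylor y (f.map (algebraMap K A)) -
      ∑ j ∈ Finset.range N, C (aeval y (hasseDeriv j f)) * X ^ j := by
    rw [X_pow_dvd_iff]
    intro i hi
    have hh : hasseDeriv i (f.map (algebraMap K A)) = (hasseDeriv i f).map (algebraMap K A) := by
      ext; simp [hasseDeriv_coeff]
    simp [finsetSum_coeff, coeff_C_mul, coeff_X_pow, hi, taylor_coeff, hh, eval_map_algebraMap]
  obtain ⟨g, hg⟩ := h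
  have h := congrArg (eval s) hg
  simp only [eval_pow, eval_X, eval_sub, taylor_eval, eval_finsetSum, eval_mul, eval_C,
    eval_map_algebraMap] at h
  refine ⟨eval s g, ?_⟩
  rw [add_comm y s, ← h]
  simp only [mul_comm]

/-- Lagrange inversion: `∑ t ^ k inverseCoeff q k` inverts `X + t q(X)`. -/
theorem pow_dvd_sum_inverseCoeff {K A : Type*} [Field K] [CharZero K] [CommRing A] [Algebra K A]
    (q : K[X]) (y T : A) (N : ℕ) :
    T ^ (N + 1) ∣ ∑ k ∈ Finset.range (N + 1), T ^ k * aeval (y + T * aeval y q) (inverseCoeff q k)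
      - y := by
  -- Grouped by total order `n = k + j`, every group with `n ≠ 0` cancels.
  have h1 : ∑ k ∈ Finset.range (N + 1), ∑ j ∈ Finset.range (N + 1 - k),
      T ^ (k + j) * aeval y (q ^ j * hasseDeriv j (inverseCoeff q k)) = y := by
    rw [← Finset.sum_range_diag_flip (N + 1)
      (fun k j => T ^ (k + j) * aeval y (q ^ j * hasseDeriv j (inverseCoeff q k))),
      Finset.sum_eq_single 0]
    · simp [inverseCoeff]
    · intro n _ hn
      have : ∀ k ∈ Finset.range (n + 1),
          T ^ (k + (n - k)) * aeval y (q ^ (n - k) * hasseDeriv (n - k) (inverseCoeff q k)) =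
          T ^ n * aeval y (q ^ (n - k) * hasseDeriv (n - k) (inverseCoeff q k)) := by
        intro k hk
        rw [Nat.add_sub_cancel' (Nat.lt_succ_iff.1 (Finset.mem_range.1 hk))]
      rw [Finset.sum_congr rfl this, ← Finset.mul_sum, ← map_sum,
        sum_pow_mul_hasseDeriv_inverseCoeff q hn]
      simp
    · simp
  suffices h : T ^ (N + 1) ∣
      ∑ k ∈ Finset.range (N + 1), T ^ k * aeval (y + T * aeval y q) (inverseCoeff q k) -
      ∑ k ∈ Finset.range (N + 1), ∑ j ∈ Finset.range (N + 1 - k),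
        T ^ (k + j) * aeval y (q ^ j * hasseDeriv j (inverseCoeff q k)) by
    rwa [h1] at h
  rw [← Finset.sum_sub_distrib]
  refine Finset.dvd_sum fun k hk => ?_
  have hk : k ≤ N + 1 := (Finset.mem_range.1 hk).le
  have h2 := mul_dvd_mul_left (T ^ k)
    (((pow_dvd_pow_of_dvd (dvd_mul_right T (aeval y q)) (N + 1 - k))).trans
      (pow_dvd_aeval_add_sub (inverseCoeff q k) y (T * aeval y q) (N + 1 - k)))
  rw [← pow_add, Nat.add_sub_cancel' hk, mul_sub, Finset.mul_sum] at h2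
  convert! h2 using 3
  rw [map_mul, map_pow]
  ring

/-- Perturbed Lagrange inversion, to one order beyond the truncation. -/
theorem pow_dvd_perturbed_sum_inverseCoeff {K A : Type*} [Field K] [CharZero K] [CommRing A]
    [Algebra K A] (q b : K[X]) (x y T : A) (m : ℕ) :
    T ^ (m + 2) ∣
      (∑ k ∈ Finset.range (m + 1),
          T ^ k * aeval (y + T * aeval y q + T ^ (m + 1) * x) (inverseCoeff q k)
        + T ^ (m + 1) * aeval (y + T * aeval y q + T ^ (m + 1) * x) b)
      - (y + T ^ (m + 1) * (x + aeval y (b - inverseCoeff q (m + 1)))) := by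
  have hsub : ∀ (f : K[X]) (u v : A), u - v ∣ aeval u f - aeval v f := by
    intro f u v
    simpa only [eval_map_algebraMap] using sub_dvd_eval_sub u v (f.map (algebraMap K A))
  set U' := y + T * aeval y q with hU'
  have h0 := pow_dvd_sum_inverseCoeff q y T (m + 1)
  -- Split off `k = m + 1`, the term missing from the truncation, and `k = 0`, the only term that
  -- feels the shift by `T^(m+1) x` modulo `T^(m+2)`.
  rw [← hU', Finset.sum_range_succ, Finset.sum_range_succ'] at h0
  rw [Finset.sum_range_succ']
  have h1 : T ^ (m + 2) ∣ ∑ k ∈ Finset.range m,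
      (T ^ (k + 1) * aeval (U' + T ^ (m + 1) * x) (inverseCoeff q (k + 1)) -
        T ^ (k + 1) * aeval U' (inverseCoeff q (k + 1))) := by
    refine Finset.dvd_sum fun k _ => ?_
    rw [← mul_sub]
    have : T ^ (m + 1) ∣ _ := (Dvd.intro x (by ring)).trans
      (hsub (inverseCoeff q (k + 1)) (U' + T ^ (m + 1) * x) U')
    refine Dvd.dvd.trans ?_ (mul_dvd_mul_left (T ^ (k + 1)) this)
    rw [← pow_add]
    exact pow_dvd_pow _ (by omega)
  have h2 : T ^ (m + 2) ∣ T ^ (m + 1) * (aeval (U' + T ^ (m + 1) * x) b - aeval y b) := by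
    rw [pow_succ _ (m + 1)]
    exact mul_dvd_mul_left _ ((Dvd.intro (aeval y q + T ^ m * x) (by rw [hU']; ring)).trans
      (hsub b _ _))
  have h3 : T ^ (m + 2) ∣ T ^ (m + 1) *
      (aeval U' (inverseCoeff q (m + 1)) - aeval y (inverseCoeff q (m + 1))) := by
    rw [pow_succ _ (m + 1)]
    exact mul_dvd_mul_left _ ((Dvd.intro (aeval y q) (by rw [hU']; ring)).trans (hsub _ _ _))
  rw [Finset.sum_sub_distrib] at h1
  convert! dvd_add (dvd_sub (dvd_add h0 h1) h3) h2 using 1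
  simp only [inverseCoeff, aeval_X, pow_zero, map_sub]
  ring

/-! ### Approximate roots and the choice of `q` -/

theorem exists_iterate_derivative_eq {K : Type*} [Field K] [CharZero K] (m : ℕ) (P : K[X]) :
    ∃ R : K[X], derivative^[m] R = P ∧ ∀ n, P.natDegree < n → R.coeff (n + m) = 0 := by
  refine ⟨P.sum fun n c => monomial (n + m) (c / ((n + m).descFactorial m : K)), ?_, ?_⟩
  · rw [sum_def, iterate_derivative_sum]
    conv_rhs => rw [P.as_sum_support]
    refine Finset.sum_congr rfl fun n _ => ?_
    ext j
    rw [coeff_iterate_derivative, coeff_monomial, coeff_monomial]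
    by_cases h : n = j
    · subst h
      have : ((n + m).descFactorial m : K) ≠ 0 := by
        rw [Nat.cast_ne_zero, Ne, Nat.descFactorial_eq_zero_iff_lt]; omega
      simp [mul_div_cancel₀, this]
    · simp [h]
  · intro n hn
    rw [sum_def, finsetSum_coeff]
    refine Finset.sum_eq_zero fun j hj => ?_
    rw [coeff_monomial, if_neg]
    have := le_natDegree_of_mem_supp _ hj
    omega

/-- The coefficients of `q` are solved from the top down: the leading one is an `(m + 1)`-th root,
and each later one enters linearly with the nonzero factor `(m + 1) q_E^m`. -/
theorem exists_pow_approx {K : Type*} [Field K] [CharZero K] [IsAlgClosed K] (m E : ℕ)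
    (R : K[X]) (hR : R.natDegree = (m + 1) * E) (hR0 : R ≠ 0) :
    ∃ q : K[X], q.natDegree = E ∧ ∀ j, m * E ≤ j → (q ^ (m + 1)).coeff j = R.coeff j := by
  suffices H : ∀ i ≤ E, ∃ q : K[X], q.natDegree ≤ E ∧ q.coeff E ≠ 0 ∧
      ∀ j, m * E + (E - i) ≤ j → (q ^ (m + 1)).coeff j = R.coeff j by
    obtain ⟨q, h1, h2, h3⟩ := H E le_rfl
    exact ⟨q, natDegree_eq_of_le_of_coeff_ne_zero h1 h2, by simpa using h3⟩
  intro i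
  induction i with
  | zero =>
    intro _
    obtain ⟨a, ha⟩ := IsAlgClosed.exists_pow_nat_eq (R.coeff ((m + 1) * E)) (Nat.succ_pos m)
    have hc : R.coeff ((m + 1) * E) ≠ 0 := by
      rw [← hR]; exact leadingCoeff_ne_zero.2 hR0
    refine ⟨C a * X ^ E, natDegree_C_mul_X_pow_le a E, ?_, fun j hj => ?_⟩
    · rw [coeff_C_mul, coeff_X_pow_self, mul_one]
      rintro rfl
      exact hc (by rw [← ha]; simp)
    · rw [mul_pow, ← C_pow, ← pow_mul, coeff_C_mul_X_pow]
      split_ifs with h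
      · rw [h, mul_comm E]; exact ha
      · rw [coeff_eq_zero_of_natDegree_lt]
        rw [hR]
        have : (m + 1) * E = m * E + E := by ring
        have : E * (m + 1) = m * E + E := by ring
        have h' : j ≠ E * (m + 1) := h
        omega
  | succ i ih =>
    intro hi
    obtain ⟨q, h1, h2, h3⟩ := ih (by omega)
    set l := E - (i + 1) with hl
    set s := (R.coeff (m * E + l) - (q ^ (m + 1)).coeff (m * E + l)) /
      ((m + 1 : K) * q.coeff E ^ m) with hs
    have hm : (m + 1 : K) ≠ 0 := by exact_mod_cast Nat.succ_ne_zero m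
    have h1' : (q + C s * X ^ l).natDegree ≤ E :=
      natDegree_add_le_of_degree_le h1 ((natDegree_C_mul_X_pow_le s l).trans (by omega))
    have h2' : (q + C s * X ^ l).coeff E = q.coeff E := by
      rw [coeff_add, coeff_C_mul_X_pow, if_neg (by omega), add_zero]
    set G := ∑ k ∈ Finset.range (m + 1), (q + C s * X ^ l) ^ k * q ^ (m - k) with hG
    have hexp : (q + C s * X ^ l) ^ (m + 1) = q ^ (m + 1) + C s * (G * X ^ l) := by
      have := geom_sum₂_mul (q + C s * X ^ l) q (m + 1)
      simp only [Nat.add_sub_cancel] at this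
      linear_combination -this
    have hterm : ∀ k ∈ Finset.range (m + 1), k * E + (m - k) * E = m * E := by
      intro k hk
      rw [← add_mul, Nat.add_sub_cancel' (Nat.lt_succ_iff.1 (Finset.mem_range.1 hk))]
    have hGdeg : G.natDegree ≤ m * E := by
      refine natDegree_sum_le_of_forall_le _ _ fun k hk => ?_
      rw [← hterm k hk]
      exact natDegree_mul_le_of_le (natDegree_pow_le_of_le k h1') (natDegree_pow_le_of_le _ h1)
    have hGcoeff : G.coeff (m * E) = (m + 1 : K) * q.coeff E ^ m := by
      rw [hG, finsetSum_coeff, Finset.sum_congr rfl (g := fun _ => q.coeff E ^ m)]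
      · simp
      · intro k hk
        rw [← hterm k hk, coeff_mul_add_eq_of_natDegree_le (natDegree_pow_le_of_le k h1')
          (natDegree_pow_le_of_le _ h1), coeff_pow_of_natDegree_le h1',
          coeff_pow_of_natDegree_le h1, h2', ← pow_add,
          Nat.add_sub_cancel' (Nat.lt_succ_iff.1 (Finset.mem_range.1 hk))]
    -- As `deg G ≤ m E`, the correction leaves the coefficients above `m E + l` unchanged, and `s`
    -- fixes that one.
    refine ⟨q + C s * X ^ l, h1', h2' ▸ h2, fun j hj => ?_⟩
    obtain ⟨j, rfl⟩ : ∃ j', j = j' + l := ⟨j - l, by omega⟩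
    rw [hexp, coeff_add, coeff_C_mul, coeff_mul_X_pow]
    rcases eq_or_lt_of_le (show m * E ≤ j by omega) with h | h
    · rw [← h, hGcoeff, hs]
      field_simp
      ring
    · rw [coeff_eq_zero_of_natDegree_lt (hGdeg.trans_lt h), mul_zero, add_zero]
      exact h3 _ (by omega)

theorem exists_natDegree_add_inverseCoeff_le {K : Type*} [Field K] [CharZero K] [IsAlgClosed K]
    (m e : ℕ) (P : K[X]) (hP : P.natDegree = (m + 1) * e + 1) :
    ∃ q : K[X], q.natDegree = e + 1 ∧ (P + inverseCoeff q (m + 1)).natDegree ≤ m * e := by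
  obtain ⟨R₀, hR₀, hR₀'⟩ := exists_iterate_derivative_eq m P
  set c : K := (-1) ^ (m + 1) / ((m + 1).factorial : K) with hc
  have hc0 : c ≠ 0 :=
    div_ne_zero (pow_ne_zero _ (by simp)) (by exact_mod_cast Nat.factorial_ne_zero (m + 1))
  have hidx : (m + 1) * e + 1 + m = (m + 1) * (e + 1) := by ring
  have htop : (C (-c⁻¹) * R₀).coeff ((m + 1) * (e + 1)) ≠ 0 := by
    rw [coeff_C_mul, ← hidx]
    refine mul_ne_zero (by simpa using hc0) fun h => ?_
    have h2 : P.coeff ((m + 1) * e + 1) = 0 := by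
      rw [← hR₀, coeff_iterate_derivative, h, smul_zero]
    rw [← hP, coeff_natDegree, leadingCoeff_eq_zero] at h2
    rw [h2] at hP
    simp at hP
  obtain ⟨q, hq, hqR⟩ := exists_pow_approx m (e + 1) (C (-c⁻¹) * R₀) (by
    refine natDegree_eq_of_le_of_coeff_ne_zero (natDegree_le_iff_coeff_eq_zero.2 fun N hN => ?_)
      htop
    obtain ⟨n, rfl⟩ : ∃ n, N = n + m := ⟨N - m, by omega⟩
    rw [coeff_C_mul, hR₀' n (by omega), mul_zero]) (fun h => htop (by rw [h, coeff_zero]))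
  refine ⟨q, hq, natDegree_le_iff_coeff_eq_zero.2 fun N hN => ?_⟩
  -- Agreement from index `m (e + 1)` on becomes, after `m` derivatives, agreement from `m e` on.
  rw [inverseCoeff, coeff_add, coeff_C_mul, ← hR₀, coeff_iterate_derivative,
    coeff_iterate_derivative, hqR (N + m) (by rw [mul_add]; omega), coeff_C_mul, ← hc,
    nsmul_eq_mul, nsmul_eq_mul]
  field_simp
  ring

/-! ### Degrees of the inverse coefficients and of the truncation -/

theorem natDegree_inverseCoeff_le {K : Type*} [Field K] {q : K[X]} {e : ℕ}
    (hq : q.natDegree = e + 1) (k : ℕ) : (inverseCoeff q k).natDegree ≤ k * e + 1 := by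
  cases k with
  | zero => simp [inverseCoeff]
  | succ k =>
    refine (natDegree_C_mul_le _ _).trans ((natDegree_iterate_derivative _ k).trans ?_)
    rw [natDegree_pow, hq]
    have : (k + 1) * (e + 1) = (k + 1) * e + 1 + k := by ring
    omega

theorem coeff_inverseCoeff_ne_zero {K : Type*} [Field K] [CharZero K] {q : K[X]} {e : ℕ}
    (hq : q.natDegree = e + 1) (k : ℕ) : (inverseCoeff q k).coeff (k * e + 1) ≠ 0 := by
  cases k with
  | zero => simp [inverseCoeff]
  | succ k =>
    rw [inverseCoeff, coeff_C_mul, coeff_iterate_derivative, nsmul_eq_mul]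
    have h1 : (k + 1) * e + 1 + k = (k + 1) * q.natDegree := by rw [hq]; ring
    refine mul_ne_zero (div_ne_zero (pow_ne_zero _ (by simp))
      (by exact_mod_cast Nat.factorial_ne_zero (k + 1))) (mul_ne_zero ?_ ?_)
    · rw [Nat.cast_ne_zero, Ne, Nat.descFactorial_eq_zero_iff_lt]; omega
    · rw [h1, coeff_pow_mul_natDegree]
      refine pow_ne_zero _ (leadingCoeff_ne_zero.2 fun h => ?_)
      simp [h] at hq

/-- The inverse of `X + t q(X)` truncated after order `m`, corrected by `t ^ (m + 1) b`. -/
def truncatedInverse {K : Type*} [Field K] (q b : K[X]) (m : ℕ) (t : K) : K[X] :=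
  ∑ k ∈ Finset.range (m + 1), C (t ^ k) * inverseCoeff q k + C (t ^ (m + 1)) * b

theorem natDegree_truncatedInverse {K : Type*} [Field K] [CharZero K] {q b : K[X]} {m e : ℕ}
    {t : K} (hq : q.natDegree = e + 1) (hb : b.natDegree ≤ m * e) (he : e ≠ 0) (ht : t ≠ 0) :
    (truncatedInverse q b m t).natDegree = m * e + 1 := by
  have h1 : (∑ k ∈ Finset.range m, C (t ^ k) * inverseCoeff q k).natDegree ≤ m * e := by
    refine natDegree_sum_le_of_forall_le _ _ fun k hk => ?_
    refine (natDegree_C_mul_le _ _).trans ((natDegree_inverseCoeff_le hq k).trans ?_)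
    -- Since `e ≥ 1`, `k e + 1 ≤ (k + 1) e ≤ m e` for `k < m`, so only `k = m` reaches degree `m e +
    -- 1`.
    have h2 : (k + 1) * e ≤ m * e := Nat.mul_le_mul_right _ (Finset.mem_range.1 hk)
    have h3 : (k + 1) * e = k * e + e := by ring
    omega
  have h2 : (C (t ^ (m + 1)) * b).natDegree ≤ m * e := (natDegree_C_mul_le _ _).trans hb
  rw [truncatedInverse, Finset.sum_range_succ]
  refine natDegree_eq_of_le_of_coeff_ne_zero ?_ ?_
  · refine natDegree_add_le_of_degree_le (natDegree_add_le_of_degree_le (by omega) ?_) (by omega)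
    exact (natDegree_C_mul_le _ _).trans (natDegree_inverseCoeff_le hq m)
  · rw [coeff_add, coeff_add, coeff_eq_zero_of_natDegree_lt (Nat.lt_succ_of_le h1),
      coeff_eq_zero_of_natDegree_lt (Nat.lt_succ_of_le h2), zero_add, add_zero, coeff_C_mul]
    exact mul_ne_zero (pow_ne_zero _ ht) (coeff_inverseCoeff_ne_zero hq m)

end Polynomial

namespace PlaneAut

/-! ### Polynomial one-parameter families and the Zariski closure -/

/-- Specialization of the parameter of a polynomial over `K[t]`. -/
def specialize {K : Type*} [Field K] (t : K) :
    MvPolynomial (Fin 2) (Polynomial K) →ₐ[K] MvPolynomial (Fin 2) K :=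
  MvPolynomial.mapAlgHom (Polynomial.aeval t)

theorem specialize_X {K : Type*} [Field K] (t : K) (i : Fin 2) :
    specialize t (MvPolynomial.X i) = MvPolynomial.X i := by
  simp [specialize]

theorem specialize_C {K : Type*} [Field K] (t : K) (p : Polynomial K) :
    specialize t (MvPolynomial.C p) = MvPolynomial.C (p.eval t) := by
  simp [specialize]

theorem coeff_specialize {K : Type*} [Field K] (t : K) (F : MvPolynomial (Fin 2) (Polynomial K))
    (n : Fin 2 →₀ ℕ) : (specialize t F).coeff n = (F.coeff n).eval t := by
  simp [specialize, MvPolynomial.coeff_map]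

/-- A family of automorphisms whose components are polynomial in the parameter. -/
def IsPolynomialFamily {K : Type*} [Field K] (θ : K → PlaneAut K) : Prop :=
  ∃ F : Fin 2 → MvPolynomial (Fin 2) (Polynomial K), ∀ t i, (θ t).coord i = specialize t (F i)

theorem IsPolynomialFamily.const_mul {K : Type*} [Field K] {θ : K → PlaneAut K}
    (h : IsPolynomialFamily θ) (α : PlaneAut K) : IsPolynomialFamily fun t => α * θ t := by
  obtain ⟨F, hF⟩ := h
  refine ⟨fun i => MvPolynomial.aeval F (α.coord i), fun t i => ?_⟩
  rw [coord_mul, MvPolynomial.comp_aeval_apply]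
  congr 2
  exact funext (hF t)

theorem IsPolynomialFamily.mul_const {K : Type*} [Field K] {θ : K → PlaneAut K}
    (h : IsPolynomialFamily θ) (α : PlaneAut K) : IsPolynomialFamily fun t => θ t * α := by
  obtain ⟨F, hF⟩ := h
  refine ⟨fun i => MvPolynomial.aeval
    (fun j => MvPolynomial.map Polynomial.C (α.coord j)) (F i), fun t i => ?_⟩
  rw [coord_mul, hF]
  dsimp only
  generalize F i = G
  induction G using MvPolynomial.induction_on with
  | C a => simp [specialize_C, MvPolynomial.algebraMap_eq]
  | add p q hp hq => simp only [map_add, hp, hq]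
  | mul_X p j hp =>
    simp only [map_mul, hp, specialize_X, MvPolynomial.aeval_X]
    congr 1
    ext n
    rw [coeff_specialize, MvPolynomial.coeff_map, Polynomial.eval_C]

/-- Along the family, each equation of the closure becomes a polynomial in `t` with infinitely many
roots, hence zero. The uniform degree bound keeps the family inside one `𝒢_{≤ n}`. -/
theorem IsPolynomialFamily.mem_closure {K : Type*} [Field K] [Infinite K] {θ : K → PlaneAut K}
    (h : IsPolynomialFamily θ) {A : Set (PlaneAut K)} (hA : ∀ t ≠ 0, θ t ∈ A) :
    θ 0 ∈ closure A := by
  obtain ⟨F, hF⟩ := h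
  have hdeg : ∀ t, (θ t).degree ≤ max (F 0).totalDegree (F 1).totalDegree := by
    intro t
    refine max_le_max ?_ ?_ <;>
    · rw [hF]
      exact Finset.sup_mono (MvPolynomial.support_map_subset _ _)
  obtain ⟨S, hS⟩ := (isClosed_iff (closure A)).1 isClosed_closure
    (max (F 0).totalDegree (F 1).totalDegree)
  rw [hS _ (hdeg 0)]
  intro f hf
  set g : Polynomial K := MvPolynomial.aeval
    (fun p : Fin 2 × (Fin 2 →₀ ℕ) => (F p.1).coeff p.2) f with hg
  have heval : ∀ t, MvPolynomial.eval (θ t).coeffs f = g.eval t := by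
    intro t
    rw [hg, ← Polynomial.coe_aeval_eq_eval, MvPolynomial.comp_aeval_apply,
      MvPolynomial.aeval_eq_eval]
    congr 2
    funext p
    rw [coeffs, hF, coeff_specialize, Polynomial.coe_aeval_eq_eval]
  have hg0 : g = 0 := by
    refine Polynomial.eq_zero_of_infinite_isRoot g
      ((Set.finite_singleton (0 : K)).infinite_compl.mono fun t ht => ?_)
    rw [Set.mem_ofPred_eq, Polynomial.IsRoot, ← heval]
    exact (hS _ (hdeg t)).1 (subset_closure (hA t ht)) f hf
  rw [heval, hg0, Polynomial.eval_zero]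

/-! ### Triangular automorphisms, the swap, and their degrees -/

/-- The triangular automorphism `(aX + P(Y), bY + c)`. -/
def mkTriangular {K : Type*} [Field K] (a b c : K) (P : Polynomial K) (ha : a ≠ 0) (hb : b ≠ 0) :
    PlaneAut K :=
  MulOpposite.op <| AlgEquiv.ofAlgHom
    (MvPolynomial.aeval ![MvPolynomial.C a * MvPolynomial.X 0 +
        Polynomial.aeval (MvPolynomial.X 1) P,
      MvPolynomial.C b * MvPolynomial.X 1 + MvPolynomial.C c])
    (MvPolynomial.aeval ![MvPolynomial.C a⁻¹ * (MvPolynomial.X 0 -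
        Polynomial.aeval (MvPolynomial.C b⁻¹ * (MvPolynomial.X 1 - MvPolynomial.C c)) P),
      MvPolynomial.C b⁻¹ * (MvPolynomial.X 1 - MvPolynomial.C c)])
    (by
      have h1 : (MvPolynomial.C a⁻¹ * MvPolynomial.C a : MvPolynomial (Fin 2) K) = 1 := by
        rw [← MvPolynomial.C_mul, inv_mul_cancel₀ ha, MvPolynomial.C_1]
      have h2 : (MvPolynomial.C b⁻¹ * MvPolynomial.C b : MvPolynomial (Fin 2) K) = 1 := by
        rw [← MvPolynomial.C_mul, inv_mul_cancel₀ hb, MvPolynomial.C_1]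
      refine MvPolynomial.algHom_ext fun i => ?_
      fin_cases i
      · simp [← Polynomial.aeval_algHom_apply, ← mul_assoc, h1, h2, MvPolynomial.algebraMap_eq]
      · simp [← mul_assoc, h2, MvPolynomial.algebraMap_eq])
    (by
      have h1 : (MvPolynomial.C a * MvPolynomial.C a⁻¹ : MvPolynomial (Fin 2) K) = 1 := by
        rw [← MvPolynomial.C_mul, mul_inv_cancel₀ ha, MvPolynomial.C_1]
      have h2 : (MvPolynomial.C b * MvPolynomial.C b⁻¹ : MvPolynomial (Fin 2) K) = 1 := by
        rw [← MvPolynomial.C_mul, mul_inv_cancel₀ hb, MvPolynomial.C_1]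
      refine MvPolynomial.algHom_ext fun i => ?_
      fin_cases i
      · simp [← Polynomial.aeval_algHom_apply, ← mul_assoc, h1, MvPolynomial.algebraMap_eq]
      · simp [← mul_assoc, h2, MvPolynomial.algebraMap_eq])

theorem coord_mkTriangular {K : Type*} [Field K] (a b c : K) (P : Polynomial K) (ha : a ≠ 0)
    (hb : b ≠ 0) (i : Fin 2) :
    (mkTriangular a b c P ha hb).coord i = ![MvPolynomial.C a * MvPolynomial.X 0 +
        Polynomial.aeval (MvPolynomial.X 1) P,
      MvPolynomial.C b * MvPolynomial.X 1 + MvPolynomial.C c] i :=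
  MvPolynomial.aeval_X _ i

theorem mkTriangular_mem_triangular {K : Type*} [Field K] (a b c : K) (P : Polynomial K)
    (ha : a ≠ 0) (hb : b ≠ 0) : mkTriangular a b c P ha hb ∈ triangular K :=
  ⟨a, b, c, P, ha, hb, by simp [coord_mkTriangular], by simp [coord_mkTriangular]⟩

/-- The affine automorphism `(Y, X)`. -/
def swap (K : Type*) [Field K] : PlaneAut K :=
  MulOpposite.op (MvPolynomial.renameEquiv K (Equiv.swap (0 : Fin 2) 1))

theorem coord_swap {K : Type*} [Field K] (i : Fin 2) :
    (swap K).coord i = MvPolynomial.X (Equiv.swap 0 1 i) :=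
  MvPolynomial.rename_X _ i

theorem swap_mem_affine (K : Type*) [Field K] : swap K ∈ affine K := by
  simp [affine, degree, coord_swap]

theorem coeff_linear {K : Type*} [Field K] (b c : K) :
    (MvPolynomial.C b * MvPolynomial.X 1 + MvPolynomial.C c : MvPolynomial (Fin 2) K).coeff
      (Finsupp.single 1 1) = b := by
  have : (0 : Fin 2 →₀ ℕ) ≠ Finsupp.single 1 1 := fun h => by
    simpa using DFunLike.congr_fun h 1
  simp [MvPolynomial.coeff_C_mul, MvPolynomial.coeff_C, this]

theorem swap_notMem_triangular (K : Type*) [Field K] : swap K ∉ triangular K := by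
  rintro ⟨a, b, c, P, ha, hb, -, h⟩
  have := congrArg (MvPolynomial.coeff (Finsupp.single (1 : Fin 2) 1)) h
  rw [coord_swap, coeff_linear, MvPolynomial.coeff_X, if_neg] at this
  · exact hb this.symm
  · intro h
    simpa using DFunLike.congr_fun h 1

theorem degree_eq_of_triangular {K : Type*} [Field K] {θ : PlaneAut K} {a b c : K}
    {P : Polynomial K} (hb : b ≠ 0)
    (h0 : θ.coord 0 = MvPolynomial.C a * MvPolynomial.X 0 + Polynomial.aeval (MvPolynomial.X 1) P)
    (h1 : θ.coord 1 = MvPolynomial.C b * MvPolynomial.X 1 + MvPolynomial.C c) :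
    θ.degree = max 1 P.natDegree := by
  have haeval : Polynomial.aeval (MvPolynomial.X 1 : MvPolynomial (Fin 2) K) P =
      ∑ n ∈ Finset.range (P.natDegree + 1), MvPolynomial.monomial (Finsupp.single 1 n)
        (P.coeff n) := by
    rw [Polynomial.aeval_eq_sum_range]
    refine Finset.sum_congr rfl fun n _ => ?_
    rw [MvPolynomial.smul_eq_C_mul, MvPolynomial.X_pow_eq_monomial, MvPolynomial.C_mul_monomial,
      mul_one]
  have hCX : ∀ (r : K) (i : Fin 2),
      (MvPolynomial.C r * MvPolynomial.X i : MvPolynomial (Fin 2) K).totalDegree ≤ 1 :=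
    fun r i => (MvPolynomial.totalDegree_mul _ _).trans (by simp)
  apply le_antisymm
  · refine max_le ?_ ?_
    · rw [h0, haeval]
      refine (MvPolynomial.totalDegree_add _ _).trans (max_le_max (hCX a 0) ?_)
      refine MvPolynomial.totalDegree_finsetSum_le fun n hn => ?_
      refine (MvPolynomial.totalDegree_monomial_le _ _).trans ?_
      rw [Finsupp.sum_single_index rfl]
      exact Nat.lt_succ_iff.1 (Finset.mem_range.1 hn)
    · rw [h1]
      refine (MvPolynomial.totalDegree_add _ _).trans (max_le ((hCX b 1).trans ?_) ?_)
      · exact le_max_left _ _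
      · simp
  · refine max_le ?_ ?_
    · refine le_max_of_le_right ?_
      have : Finsupp.single (1 : Fin 2) 1 ∈ (θ.coord 1).support := by
        rwa [MvPolynomial.mem_support_iff, h1, coeff_linear]
      simpa using MvPolynomial.le_totalDegree this
    · rcases Nat.eq_zero_or_pos P.natDegree with hP | hP
      · rw [hP]; exact Nat.zero_le _
      refine le_max_of_le_left ?_
      have : Finsupp.single (1 : Fin 2) P.natDegree ∈ (θ.coord 0).support := by
        rw [MvPolynomial.mem_support_iff, h0, haeval]
        have hne : (Finsupp.single (0 : Fin 2) 1) ≠ Finsupp.single (1 : Fin 2) P.natDegree := by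
          intro h
          have := DFunLike.congr_fun h 0
          simp at this
        rw [MvPolynomial.coeff_add, MvPolynomial.coeff_C_mul, MvPolynomial.coeff_X, if_neg hne,
          MvPolynomial.coeff_sum, Finset.sum_eq_single P.natDegree]
        · simp only [mul_zero, zero_add, MvPolynomial.coeff_monomial, if_true]
          exact Polynomial.leadingCoeff_ne_zero.2 fun h => by simp [h] at hP
        · intro n _ hn
          rw [MvPolynomial.coeff_monomial, if_neg]
          exact fun h => hn (Finsupp.single_injective _ h)
        · simp
      simpa using MvPolynomial.le_totalDegree this

theorem degree_mkTriangular {K : Type*} [Field K] (a b c : K) (P : Polynomial K)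
    (ha : a ≠ 0) (hb : b ≠ 0) : (mkTriangular a b c P ha hb).degree = max 1 P.natDegree :=
  degree_eq_of_triangular (a := a) (c := c) hb (by simp [coord_mkTriangular]) (by simp [coord_mkTriangular])

/-! ### The degeneration and the theorem -/

open Polynomial (inverseCoeff truncatedInverse)

theorem coord_mkTriangular_mul_swap_mul {K : Type*} [Field K] {a b c a' b' c' : K}
    (P Q : Polynomial K) (ha : a ≠ 0) (hb : b ≠ 0) (ha' : a' ≠ 0) (hb' : b' ≠ 0) (i : Fin 2) :
    (mkTriangular a b c P ha hb * swap K * mkTriangular a' b' c' Q ha' hb').coord i =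
      ![MvPolynomial.C a * (MvPolynomial.C b' * MvPolynomial.X 1 + MvPolynomial.C c') +
          Polynomial.aeval (MvPolynomial.C a' * MvPolynomial.X 0 +
            Polynomial.aeval (MvPolynomial.X 1) Q) P,
        MvPolynomial.C b * (MvPolynomial.C a' * MvPolynomial.X 0 +
            Polynomial.aeval (MvPolynomial.X 1) Q) + MvPolynomial.C c] i := by
  rw [mul_assoc, coord_mul]
  have h : (swap K * mkTriangular a' b' c' Q ha' hb').coord =
      ![MvPolynomial.C b' * MvPolynomial.X 1 + MvPolynomial.C c',
        MvPolynomial.C a' * MvPolynomial.X 0 + Polynomial.aeval (MvPolynomial.X 1) Q] := by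
    funext j
    rw [coord_mul, coord_swap, MvPolynomial.aeval_X]
    fin_cases j <;> simp [coord_mkTriangular]
  rw [h]
  fin_cases i <;>
    simp [coord_mkTriangular, MvPolynomial.algebraMap_eq, ← Polynomial.aeval_algHom_apply]

theorem specialize_aeval {K : Type*} [Field K] (t : K) (u : MvPolynomial (Fin 2) (Polynomial K))
    (p : Polynomial K) :
    specialize t (Polynomial.aeval u p) = Polynomial.aeval (specialize t u) p :=
  (Polynomial.aeval_algHom_apply (specialize t) u p).symm

/-- Products `τ₁ (Y, X) τ₂` degenerating to the triangular automorphism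
`(aX + a (β - L)(Y), bY + c)`, where `L` is a coefficient of the inverse of `X + t q(X)`. -/
theorem exists_degeneration {K : Type*} [Field K] [CharZero K] (m : ℕ) (q β : Polynomial K)
    {a b c : K} (ha : a ≠ 0) (hb : b ≠ 0) {τ : PlaneAut K}
    (h0 : τ.coord 0 = MvPolynomial.C a * (MvPolynomial.X 0 +
      Polynomial.aeval (MvPolynomial.X 1) (β - inverseCoeff q (m + 1))))
    (h1 : τ.coord 1 = MvPolynomial.C b * MvPolynomial.X 1 + MvPolynomial.C c) :
    ∃ ω : K → PlaneAut K, IsPolynomialFamily ω ∧ ω 0 = τ ∧ ∀ t (ht : t ≠ 0),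
      ω t = mkTriangular (-a / t ^ (m + 1)) b c
          (Polynomial.C (a / t ^ (m + 1)) * truncatedInverse q β m t)
          (div_ne_zero (neg_ne_zero.2 ha) (pow_ne_zero _ ht)) hb * swap K *
        mkTriangular (t ^ (m + 1)) 1 0 (Polynomial.X + Polynomial.C t * q)
          (pow_ne_zero _ ht) one_ne_zero := by
  classical
  set ω : K → PlaneAut K := fun t => if ht : t = 0 then τ else
      mkTriangular (-a / t ^ (m + 1)) b c
          (Polynomial.C (a / t ^ (m + 1)) * truncatedInverse q β m t)
          (div_ne_zero (neg_ne_zero.2 ha) (pow_ne_zero _ ht)) hb * swap K *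
        mkTriangular (t ^ (m + 1)) 1 0 (Polynomial.X + Polynomial.C t * q)
          (pow_ne_zero _ ht) one_ne_zero with hω
  refine ⟨ω, ?_, dif_pos rfl, fun t ht => dif_neg ht⟩
  set x : MvPolynomial (Fin 2) (Polynomial K) := MvPolynomial.X 0 with hx
  set y : MvPolynomial (Fin 2) (Polynomial K) := MvPolynomial.X 1 with hy
  set T : MvPolynomial (Fin 2) (Polynomial K) := MvPolynomial.C Polynomial.X with hT
  obtain ⟨W, hW⟩ := Polynomial.pow_dvd_perturbed_sum_inverseCoeff q β x y T m
  set U := y + T * Polynomial.aeval y q + T ^ (m + 1) * x with hU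
  have hsT : ∀ t, specialize t T = MvPolynomial.C t := fun t => by
    rw [hT, specialize_C, Polynomial.eval_X]
  have hsU : ∀ t, specialize t U = MvPolynomial.C (t ^ (m + 1)) * MvPolynomial.X 0 +
      Polynomial.aeval (MvPolynomial.X 1) (Polynomial.X + Polynomial.C t * q) := fun t => by
    rw [hU, map_add, map_add, map_mul, map_mul, map_pow, hsT, specialize_aeval, hx, hy,
      specialize_X, specialize_X]
    simp [MvPolynomial.algebraMap_eq]
    ring
  -- The quotient `W` of the congruence modulo `T^(m+2)` is the error term; after division by
  -- `T^(m+1)` it carries one factor `T` and so dies at `t = 0`.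
  refine ⟨![MvPolynomial.C (Polynomial.C a) *
      (x + Polynomial.aeval y (β - inverseCoeff q (m + 1)) + T * W),
    MvPolynomial.C (Polynomial.C b) * U + MvPolynomial.C (Polynomial.C c)], fun t i => ?_⟩
  by_cases ht : t = 0
  · subst ht
    have hω0 : ω 0 = τ := dif_pos rfl
    rw [hω0]
    fin_cases i
    · simp only [Fin.zero_eta, Matrix.cons_val_zero]
      rw [h0, map_mul, map_add, map_add, map_mul, specialize_aeval, specialize_C, hx, hy,
        specialize_X, specialize_X, hsT]
      simp
    · simp only [Fin.mk_one, Matrix.cons_val_one, Matrix.cons_val_fin_one]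
      rw [h1, map_add, map_mul, specialize_C, specialize_C, hsU]
      simp
  · have hωt : ω t = _ := dif_neg ht
    rw [hωt, coord_mkTriangular_mul_swap_mul]
    fin_cases i
    · simp only [Fin.zero_eta, Matrix.cons_val_zero]
      rw [← hsU]
      have hW' := congrArg (specialize t) hW
      simp only [map_sub, map_add, map_mul, map_pow, map_sum, hsT, specialize_aeval] at hW' ⊢
      rw [hx, hy, specialize_X, specialize_X] at *
      have hB : Polynomial.aeval (specialize t U) (truncatedInverse q β m t) =
          ∑ k ∈ Finset.range (m + 1), MvPolynomial.C t ^ k *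
            Polynomial.aeval (specialize t U) (inverseCoeff q k) +
          MvPolynomial.C t ^ (m + 1) * Polynomial.aeval (specialize t U) β := by
        simp [truncatedInverse, MvPolynomial.algebraMap_eq]
      have hdiv : (MvPolynomial.C (a / t ^ (m + 1)) : MvPolynomial (Fin 2) K) *
          MvPolynomial.C t ^ (m + 1) = MvPolynomial.C a := by
        rw [← MvPolynomial.C_pow, ← MvPolynomial.C_mul, div_mul_cancel₀ _ (pow_ne_zero _ ht)]
      rw [← hB] at hW'
      have hneg : (MvPolynomial.C (-a / t ^ (m + 1)) : MvPolynomial (Fin 2) K) =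
          -MvPolynomial.C (a / t ^ (m + 1)) := by rw [neg_div, MvPolynomial.C_neg]
      rw [hneg, specialize_C, Polynomial.eval_C, Polynomial.aeval_C, MvPolynomial.algebraMap_eq,
        MvPolynomial.C_1, MvPolynomial.C_0]
      linear_combination MvPolynomial.C (a / t ^ (m + 1)) * hW' +
        (MvPolynomial.X 0 + (Polynomial.aeval (MvPolynomial.X 1) β -
          Polynomial.aeval (MvPolynomial.X 1) (inverseCoeff q (m + 1))) +
          MvPolynomial.C t * specialize t W) * hdiv
    · simp only [Fin.mk_one, Matrix.cons_val_one, Matrix.cons_val_fin_one]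
      rw [map_add (specialize t), map_mul (specialize t), specialize_C, specialize_C, hsU]
      simp

theorem polydegreeSet_subset_closure (d e m : ℕ) (hd : 2 ≤ d) (he : 2 ≤ e) (hm : d - 1 = m * e) :
    polydegreeSet ℂ ![d + e] ⊆ closure (polydegreeSet ℂ ![d, e + 1]) := by
  rintro θ ⟨α, τ, hα, -, hτ, rfl⟩
  obtain ⟨⟨a, b, c, P, ha, hb, h0, h1⟩, -, hdeg⟩ := hτ 0
  obtain rfl : d = m * e + 1 := by omega
  rw [degree_eq_of_triangular hb h0 h1] at hdeg
  have hP : P.natDegree = (m + 1) * e + 1 := by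
    simp only [Matrix.cons_val_zero, add_mul, one_mul] at hdeg ⊢
    omega
  obtain ⟨q, hq, hβ⟩ := Polynomial.exists_natDegree_add_inverseCoeff_le m e
    (Polynomial.C a⁻¹ * P) (by rw [Polynomial.natDegree_C_mul (inv_ne_zero ha), hP])
  -- Chosen so that `a (β - L_{m+1}) = P`.
  set β := Polynomial.C a⁻¹ * P + Polynomial.inverseCoeff q (m + 1) with hβdef
  obtain ⟨ω, hω, hω0, hωt⟩ := exists_degeneration (τ := τ 0) m q β ha hb (by
    rw [h0, hβdef, add_sub_cancel_right, map_mul, Polynomial.aeval_C, MvPolynomial.algebraMap_eq,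
      mul_add, ← mul_assoc, ← MvPolynomial.C_mul, mul_inv_cancel₀ ha, MvPolynomial.C_1,
      one_mul]) h1
  have key := ((hω.mul_const (α 1)).const_mul (α 0)).mem_closure
    (A := polydegreeSet ℂ ![m * e + 1, e + 1]) ?_
  · simpa [hω0] using key
  intro t ht
  have hd1 : (mkTriangular (-a / t ^ (m + 1)) b c
      (Polynomial.C (a / t ^ (m + 1)) * Polynomial.truncatedInverse q β m t)
      (div_ne_zero (neg_ne_zero.2 ha) (pow_ne_zero _ ht)) hb).degree = m * e + 1 := by
    rw [degree_mkTriangular, Polynomial.natDegree_C_mul (div_ne_zero ha (pow_ne_zero _ ht)),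
      Polynomial.natDegree_truncatedInverse hq hβ (by omega) ht]
    omega
  have hd2 : (mkTriangular (t ^ (m + 1)) 1 0 (Polynomial.X + Polynomial.C t * q)
      (pow_ne_zero _ ht) one_ne_zero).degree = e + 1 := by
    have hq' : (Polynomial.C t * q).natDegree = e + 1 := by
      rw [Polynomial.natDegree_C_mul ht, hq]
    rw [degree_mkTriangular, Polynomial.natDegree_add_eq_right_of_natDegree_lt, hq']
    · omega
    · rw [hq', Polynomial.natDegree_X]; omega
  refine ⟨![α 0, swap ℂ, α 1], ![mkTriangular (-a / t ^ (m + 1)) b c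
      (Polynomial.C (a / t ^ (m + 1)) * Polynomial.truncatedInverse q β m t)
      (div_ne_zero (neg_ne_zero.2 ha) (pow_ne_zero _ ht)) hb,
    mkTriangular (t ^ (m + 1)) 1 0 (Polynomial.X + Polynomial.C t * q)
      (pow_ne_zero _ ht) one_ne_zero], ?_, ?_, ?_, ?_⟩
  · intro i
    fin_cases i
    · exact hα 0
    · exact swap_mem_affine ℂ
    · exact hα 1
  · intro i hi0 hi1
    fin_cases i
    · exact absurd rfl hi0
    · exact swap_notMem_triangular ℂ
    · exact absurd rfl hi1
  · intro i
    fin_cases i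
    · refine ⟨mkTriangular_mem_triangular _ b c _
        (div_ne_zero (neg_ne_zero.2 ha) (pow_ne_zero _ ht)) hb, fun h => ?_, hd1⟩
      have h : _ = 1 := h
      simp only [Fin.zero_eta, Matrix.cons_val_zero] at h
      omega
    · refine ⟨mkTriangular_mem_triangular _ 1 0 _ (pow_ne_zero _ ht) one_ne_zero,
        fun h => ?_, hd2⟩
      have h : _ = 1 := h
      simp only [Fin.mk_one, Matrix.cons_val_one, Matrix.cons_val_fin_one] at h
      omega
  · simp only [hωt t ht]
    simp [List.ofFn_succ, mul_assoc]

end PlaneAut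

end

theorem mainTheorem6 (d e m : ℕ) (hd : 2 ≤ d) (he : 2 ≤ e) (hm : d - 1 = m * e) :
    PlaneAut.polydegreeSet ℂ ![d + e] ⊆ closure (PlaneAut.polydegreeSet ℂ ![d, e + 1]) :=
  PlaneAut.polydegreeSet_subset_closure d e m hd he hm
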